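/- Let $\pi:E\to B$ be a locally trivial topological fiber bundle whose fiber $F$ is path-connected (in particular nonempty): every point of $B$ has an open neighbourhood $U$ with a homeomorphism $\pi^{-1}(U)\cong U\times F$ over $U$. Assume that the base $B$ is a paracompact Hausdorff space which is homotopy equivalent to a CW complex of dimension at most one. Then there exists a continuous section of $\pi$, i.e. a continuous map $\sigma:B\to E$ with $\pi\circ\sigma=\mathrm{id}_B$. -/

import Mathlib

/-- `p : E → B` is a locally trivial topological fiber bundle with fiber `F`: every point of `B`
has an open neighbourhood `U` with a homeomorphism `p ⁻¹' U ≃ U × F` over `U`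
(a `Trivialization F p` with base set `U`). -/
def IsLocallyTrivialBundle {E B : Type*} (F : Type*) [TopologicalSpace E] [TopologicalSpace B]
    [TopologicalSpace F] (p : E → B) : Prop :=
  ∀ b : B, ∃ e : Bundle.Trivialization F p, b ∈ e.baseSet

/-- A CW structure on the whole space `X` has dimension at most `d`: there are no cells of
dimension larger than `d`. -/
def CWDimLE (X : Type*) [TopologicalSpace X] [Topology.CWComplex (Set.univ : Set X)]
    (d : ℕ) : Prop :=
  ∀ n : ℕ, d < n → IsEmpty (Topology.RelCWComplex.cell (Set.univ : Set X) n)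

/-! Let `h : B → X` be a homotopy equivalence with inverse `k`. The map `k` lifts to `E`: choose
points over the vertices and join them along the edges, which is possible because the fiber is
path-connected (`exists_lift_of_cwDimLE_one`). Composing with `h` lifts `k ∘ h`, which is homotopic
to the identity of `B`. Moving this lift along the homotopy gives a lift of the identity, a section
(`exists_lift_homotopy_end`).

The last step uses paracompactness: a partition of unity cuts the homotopy into locally finitely
many moves, each supported where a chain of trivializations transports fibers. -/

open Set Topology unitInterval

/-! ### Transport between fibers -/

section Transport

variable {Y E B F : Type*} [TopologicalSpace Y] [TopologicalSpace E] {p : E → B}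

/-- There is a continuous family of maps from the fibers of `p` over `g₀ y` to the fibers over
`g₁ y`, which is the identity for `y` outside `K`. -/
def HasTransport (p : E → B) (K : Set Y) (g₀ g₁ : Y → B) : Prop :=
  ∃ T : Y → E → E, ContinuousOn (fun w : Y × E ↦ T w.1 w.2) {w | p w.2 = g₀ w.1} ∧
    (∀ y z, p z = g₀ y → p (T y z) = g₁ y) ∧ ∀ y ∉ K, ∀ z, p z = g₀ y → T y z = z

theorem HasTransport.mono {K K' : Set Y} {g₀ g₁ : Y → B} (h : HasTransport p K g₀ g₁)
    (hK : K ⊆ K') : HasTransport p K' g₀ g₁ := by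
  obtain ⟨T, h1, h2, h3⟩ := h
  exact ⟨T, h1, h2, fun y hy ↦ h3 y fun h ↦ hy (hK h)⟩

theorem HasTransport.refl (K : Set Y) (g : Y → B) : HasTransport p K g g :=
  ⟨fun _ z ↦ z, continuous_snd.continuousOn, fun _ _ h ↦ h, fun _ _ _ _ ↦ rfl⟩

theorem HasTransport.trans {K : Set Y} {g₀ g₁ g₂ : Y → B} (h : HasTransport p K g₀ g₁)
    (h' : HasTransport p K g₁ g₂) : HasTransport p K g₀ g₂ := by
  obtain ⟨T, h1, h2, h3⟩ := h
  obtain ⟨T', h1', h2', h3'⟩ := h'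
  refine ⟨fun y z ↦ T' y (T y z), ?_, fun y z hz ↦ h2' _ _ (h2 _ _ hz), fun y hy z hz ↦ ?_⟩
  · exact h1'.comp (continuous_fst.continuousOn.prodMk h1) fun w hw ↦ h2 _ _ hw
  · exact (h3' y hy _ (h2 _ _ hz)).trans (h3 y hy z hz)

variable [TopologicalSpace B] [TopologicalSpace F]

theorem Bundle.Trivialization.continuousOn_lift (e : Bundle.Trivialization F p) :
    ContinuousOn (fun w : E × B ↦ e.lift w.1 w.2) (e.source ×ˢ e.baseSet) := by
  refine e.toOpenPartialHomeomorph.symm.continuousOn.comp (t := e.target)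
    (continuous_snd.continuousOn.prodMk (continuous_snd.comp_continuousOn
      (e.toOpenPartialHomeomorph.continuousOn.comp continuous_fst.continuousOn
        fun w hw ↦ hw.1))) ?_
  intro w hw
  exact e.mem_target.2 hw.2

-- Keep the fiber coordinate of `e` and change the base point. Off `K` this is the identity, so it
-- glues with the identity over the open complement of `K`.
open Classical in
theorem HasTransport.of_trivialization (e : Bundle.Trivialization F p) {K : Set Y}
    (hK : IsClosed K) {g₀ g₁ : Y → B} (hg₀ : Continuous g₀) (hg₁ : Continuous g₁)
    (h₀ : ∀ y ∈ K, g₀ y ∈ e.baseSet) (h₁ : ∀ y ∈ K, g₁ y ∈ e.baseSet)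
    (heq : ∀ y ∉ K, g₀ y = g₁ y) : HasTransport p K g₀ g₁ := by
  have hid : ∀ y ∉ K, ∀ z, p z = g₀ y →
      (if g₀ y ∈ e.baseSet ∧ g₁ y ∈ e.baseSet then e.lift z (g₁ y) else z) = z := by
    intro y hy z hz
    split_ifs with h
    · rw [← heq y hy, ← hz]
      exact e.lift_self (hz ▸ h.1)
    · rfl
  refine ⟨fun y z ↦ if g₀ y ∈ e.baseSet ∧ g₁ y ∈ e.baseSet then e.lift z (g₁ y) else z,
    ?_, ?_, hid⟩
  · intro w hw
    by_cases hy : w.1 ∈ K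
    · have hV : IsOpen {w : Y × E | g₀ w.1 ∈ e.baseSet ∧ g₁ w.1 ∈ e.baseSet} :=
        (e.open_baseSet.preimage (hg₀.comp continuous_fst)).inter
          (e.open_baseSet.preimage (hg₁.comp continuous_fst))
      rw [← continuousWithinAt_inter (hV.mem_nhds ⟨h₀ _ hy, h₁ _ hy⟩)]
      have hc : ContinuousOn (fun w : Y × E ↦ e.lift w.2 (g₁ w.1))
          ({w | p w.2 = g₀ w.1} ∩ {w : Y × E | g₀ w.1 ∈ e.baseSet ∧ g₁ w.1 ∈ e.baseSet}) := by
        refine e.continuousOn_lift.comp (continuous_snd.prodMk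
          (hg₁.comp continuous_fst)).continuousOn ?_
        rintro w ⟨hw, hw0, hw1⟩
        exact ⟨e.mem_source.2 (by rw [show p w.2 = g₀ w.1 from hw]; exact hw0), hw1⟩
      refine (hc.congr ?_) w ⟨hw, h₀ _ hy, h₁ _ hy⟩
      rintro w ⟨-, hw⟩
      exact if_pos hw
    · have hV : IsOpen {w : Y × E | w.1 ∉ K} := hK.isOpen_compl.preimage continuous_fst
      rw [← continuousWithinAt_inter (hV.mem_nhds hy)]
      refine (continuous_snd.continuousOn.congr ?_) w ⟨hw, hy⟩
      rintro w ⟨hw, hw'⟩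
      exact hid _ hw' _ hw
  · intro y z hz
    dsimp only
    split_ifs with h
    · exact e.proj_lift h.2
    · by_cases hy : y ∈ K
      · exact absurd ⟨h₀ y hy, h₁ y hy⟩ h
      · rw [hz, heq y hy]

/-- Transport along a homotopy from time `u` to time `v`, when on `K` the homotopy runs through
a chain of trivializations and `u = v` outside `K`. -/
theorem HasTransport.of_homotopy (H : C(Y × I, B)) {K : Set Y} (hK : IsClosed K) {u v : C(Y, I)}
    (huv : u ≤ v) (heq : ∀ y ∉ K, u y = v y) {t : ℕ → I} (ht0 : t 0 = 0) (ht : Monotone t)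
    {n : ℕ} (hn : t n = 1) (e : ℕ → Bundle.Trivialization F p)
    (he : ∀ k, ∀ y ∈ K, ∀ s ∈ Icc (t k) (t (k + 1)), H (y, s) ∈ (e k).baseSet) :
    HasTransport p K (fun y ↦ H (y, u y)) (fun y ↦ H (y, v y)) := by
  -- The time `t k` clamped to `[u y, v y]`; it runs from `u` to `v` as `k` grows.
  have hw : ∀ k, Continuous fun y ↦ max (u y) (min (v y) (t k)) := fun k ↦ by fun_prop
  suffices h : ∀ k, HasTransport p K (fun y ↦ H (y, u y))
      (fun y ↦ H (y, max (u y) (min (v y) (t k)))) by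
    have := h n
    have huv' : ∀ y, max (u y) (min (v y) (t n)) = v y := by
      intro y
      rw [hn, min_eq_left le_one', max_eq_right (show u y ≤ v y from huv y)]
    simpa only [huv'] using this
  intro k
  induction k with
  | zero =>
    have h0 : ∀ y, max (u y) (min (v y) (t 0)) = u y := by
      intro y
      rw [ht0, min_eq_right nonneg', max_eq_left nonneg']
    simp only [h0]
    exact .refl _ _
  | succ k ih =>
    -- Step `k` only moves points whose two clamped times both lie in `[t k, t (k + 1)]`; otherwise
    -- these times coincide.
    refine ih.trans (HasTransport.mono (K := K ∩
      ((fun y ↦ max (u y) (min (v y) (t k))) ⁻¹' Icc (t k) (t (k + 1)) ∩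
      (fun y ↦ max (u y) (min (v y) (t (k + 1)))) ⁻¹' Icc (t k) (t (k + 1)))) ?_
      inter_subset_left)
    refine .of_trivialization (e k) (hK.inter ((isClosed_Icc.preimage (hw k)).inter
      (isClosed_Icc.preimage (hw (k + 1))))) (H.continuous.comp (continuous_id.prodMk (hw k)))
      (H.continuous.comp (continuous_id.prodMk (hw (k + 1))))
      (fun y hy ↦ he k y hy.1 _ hy.2.1) (fun y hy ↦ he k y hy.1 _ hy.2.2) ?_
    intro y hy
    have hk : t k ≤ t (k + 1) := ht k.le_succ
    have hle : u y ≤ v y := huv y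
    by_cases hyK : y ∈ K
    · have hne : ¬ (max (u y) (min (v y) (t k)) ∈ Icc (t k) (t (k + 1)) ∧
          max (u y) (min (v y) (t (k + 1))) ∈ Icc (t k) (t (k + 1))) :=
        fun h ↦ hy ⟨hyK, h⟩
      suffices max (u y) (min (v y) (t k)) = max (u y) (min (v y) (t (k + 1))) by rw [this]
      simp only [mem_Icc] at hne
      generalize u y = a at *
      generalize v y = b at *
      generalize t k = c at *
      generalize t (k + 1) = d at *
      grind
    · have h := heq y hyK
      simp [h]

end Transport

/-! ### Moving lifts along homotopies -/

section HomotopyLifting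

variable {Z E B F : Type*} [TopologicalSpace Z] [TopologicalSpace E] [TopologicalSpace B]
  [TopologicalSpace F] {p : E → B}

/-- Subdivide the path `H (z, ·)` by compactness, then thicken `z` by the tube lemma on each of the
finitely many subintervals. From index `n` on the intervals are `{1}`. -/
theorem IsLocallyTrivialBundle.exists_subdivision (hp : IsLocallyTrivialBundle F p)
    (H : C(Z × I, B)) (z : Z) : ∃ A : Set Z, IsOpen A ∧ z ∈ A ∧ ∃ t : ℕ → I, t 0 = 0 ∧ Monotone t ∧
      (∃ n, t n = 1) ∧ ∃ e : ℕ → Bundle.Trivialization F p,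
        ∀ k, ∀ x ∈ A, ∀ s ∈ Icc (t k) (t (k + 1)), H (x, s) ∈ (e k).baseSet := by
  choose φ hφ using hp
  obtain ⟨t, ht0, ht, ⟨n, hn⟩, hc⟩ := exists_monotone_Icc_subset_open_cover_unitInterval
    (c := fun b ↦ (fun s ↦ H (z, s)) ⁻¹' (φ b).baseSet)
    (fun b ↦ (φ b).open_baseSet.preimage (by fun_prop))
    (fun s _ ↦ mem_iUnion.2 ⟨H (z, s), hφ _⟩)
  choose j hj using hc
  have hev : ∀ k, ∀ᶠ x in 𝓝 z, ∀ s ∈ Icc (t k) (t (k + 1)), H (x, s) ∈ (φ (j k)).baseSet := by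
    intro k
    refine isCompact_Icc.eventually_forall_of_forall_eventually fun s hs ↦ ?_
    exact H.continuous.continuousAt.eventually
      ((φ (j k)).open_baseSet.mem_nhds (hj k hs))
  have hev' : ∀ᶠ x in 𝓝 z, ∀ k ∈ Finset.range n, ∀ s ∈ Icc (t k) (t (k + 1)),
      H (x, s) ∈ (φ (j k)).baseSet :=
    (Filter.eventually_all_finset _).2 fun k _ ↦ hev k
  have hev1 : ∀ᶠ x in 𝓝 z, H (x, 1) ∈ (φ (H (z, 1))).baseSet :=
    (H.continuous.comp (continuous_id.prodMk continuous_const)).continuousAt.eventually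
      ((φ (H (z, 1))).open_baseSet.mem_nhds (hφ _))
  obtain ⟨A, hA, hAo, hzA⟩ := mem_nhds_iff.1 (hev'.and hev1)
  refine ⟨A, hAo, hzA, t, ht0, ht, ⟨n, hn n le_rfl⟩,
    fun k ↦ if k < n then φ (j k) else φ (H (z, 1)), fun k x hx s hs ↦ ?_⟩
  dsimp only
  split_ifs with hk
  · exact (hA hx).1 k (Finset.mem_range.2 hk) s hs
  · rw [hn k (not_lt.1 hk), hn (k + 1) (by omega), Icc_self] at hs
    rw [mem_singleton_iff.1 hs]
    exact (hA hx).2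

/-- For a locally trivial bundle, a lift of the start of a homotopy on a paracompact Hausdorff
space yields a lift of its end. -/
theorem IsLocallyTrivialBundle.exists_lift_homotopy_end [T2Space Z] [ParacompactSpace Z]
    (hp : IsLocallyTrivialBundle F p) (H : C(Z × I, B)) (f₀ : C(Z, E))
    (hf₀ : ∀ z, p (f₀ z) = H (z, 0)) : ∃ f₁ : C(Z, E), ∀ z, p (f₁ z) = H (z, 1) := by
  classical
  choose A hAo hzA t ht0 ht htn e he using fun z ↦ hp.exists_subdivision H z
  obtain ⟨ρ, hρ⟩ := PartitionOfUnity.exists_isSubordinate isClosed_univ A hAo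
    fun z _ ↦ mem_iUnion.2 ⟨z, hzA z⟩
  -- Move `i` advances time by `ρ i`, truncated at `1`.
  let v : Z → C(Z × I, I) := fun i ↦
    ⟨fun y ↦ ⟨min 1 ((y.2 : ℝ) + ρ i y.1),
      le_min zero_le_one (add_nonneg y.2.2.1 (ρ.nonneg i _)), min_le_left _ _⟩, by fun_prop⟩
  have hT : ∀ i, HasTransport p {y : Z × I | y.1 ∈ tsupport (ρ i)} (fun y ↦ H (y.1, y.2))
      (fun y ↦ H (y.1, v i y)) := by
    intro i
    obtain ⟨n, hn⟩ := htn i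
    refine HasTransport.of_homotopy (H.comp ⟨fun w : (Z × I) × I ↦ (w.1.1, w.2), by fun_prop⟩)
      (u := ⟨Prod.snd, continuous_snd⟩) (v := v i)
      ((isClosed_tsupport _).preimage continuous_fst) ?_ ?_ (ht0 i) (ht i) hn (e i) ?_
    · intro y
      exact Subtype.coe_le_coe.1 (le_min y.2.2.2 (le_add_of_nonneg_right (ρ.nonneg i _)))
    · intro y hy
      have : ρ i y.1 = 0 := image_eq_zero_of_notMem_tsupport hy
      exact Subtype.ext (by simp [v, this, y.2.2.2])
    · exact fun k y hy s hs ↦ he i k y.1 (hρ i hy) s hs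
  choose T hTc hTp hTid using hT
  -- The pullback of `E` along `H`, on which the moves act as self-maps `Φ i`.
  let W := {w : (Z × I) × E // p w.2 = H (w.1.1, w.1.2)}
  let Φ : Z → W → W := fun i w ↦ ⟨((w.1.1.1, v i w.1.1), T i w.1.1 w.1.2), hTp i _ _ w.2⟩
  have hΦ : ∀ i, Continuous (Φ i) := by
    intro i
    have h : Continuous fun w : W ↦ T i w.1.1 w.1.2 :=
      (hTc i).comp_continuous continuous_subtype_val fun w ↦ w.2
    have h' : Continuous fun w : W ↦ v i w.1.1 := (v i).continuous.comp (by fun_prop)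
    exact Continuous.subtype_mk (((by fun_prop : Continuous fun w : W ↦ w.1.1.1).prodMk h').prodMk h) _
  have hΦid : ∀ i (w : W), w.1.1.1 ∉ tsupport (ρ i) → Φ i w = w := by
    intro i w hw
    have h0 : ρ i w.1.1.1 = 0 := image_eq_zero_of_notMem_tsupport hw
    refine Subtype.ext (Prod.ext (Prod.ext rfl (Subtype.ext ?_)) (hTid i _ hw _ w.2))
    simp [Φ, v, h0, w.1.1.2.2.2]
  let w₀ : Z → W := fun z ↦ ⟨((z, 0), f₀ z), hf₀ z⟩
  have hw₀ : Continuous w₀ := Continuous.subtype_mk (by fun_prop) _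
  have hfst : ∀ (l : List Z) (w : W), (l.foldr Φ w).1.1.1 = w.1.1.1 := by
    intro l w
    induction l with
    | nil => rfl
    | cons i l ih => exact ih
  have htime : ∀ (l : List Z) (z : Z),
      ((l.foldr Φ (w₀ z)).1.1.2 : ℝ) = min 1 (l.map fun i ↦ ρ i z).sum := by
    intro l z
    induction l with
    | nil => simp [w₀]
    | cons i l ih =>
      have h1 : ((List.foldr Φ (w₀ z) (i :: l)).1.1.2 : ℝ) =
        min 1 (((l.foldr Φ (w₀ z)).1.1.2 : ℝ) + ρ i (l.foldr Φ (w₀ z)).1.1.1) := rfl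
      have h2 : (w₀ z).1.1.1 = z := rfl
      rw [h1, ih, hfst, h2, List.map_cons, List.sum_cons]
      have := ρ.nonneg i z
      rcases le_total 1 (l.map fun i ↦ ρ i z).sum with h | h
      · rw [min_eq_left h, min_eq_left (by linarith), min_eq_left (by linarith)]
      · rw [min_eq_right h, add_comm]
  have hcont : ∀ l : List Z, Continuous fun z ↦ l.foldr Φ (w₀ z) := by
    intro l
    induction l with
    | nil => exact hw₀
    | cons i l ih => exact (hΦ i).comp ih
  have hfilter : ∀ (l : List Z) (z : Z),
      (l.filter fun i ↦ z ∈ tsupport (ρ i)).foldr Φ (w₀ z) = l.foldr Φ (w₀ z) := by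
    intro l z
    induction l with
    | nil => rfl
    | cons i l ih =>
      by_cases hi : z ∈ tsupport (ρ i)
      · rw [List.filter_cons_of_pos (by simpa using hi), List.foldr_cons, ih, List.foldr_cons]
      · rw [List.filter_cons_of_neg (by simpa using hi), ih, List.foldr_cons, hΦid]
        rwa [hfst]
  -- The moves need not commute, so a global order on the indices is fixed.
  let _ : LinearOrder Z := IsWellOrder.linearOrder WellOrderingRel
  let G : Z → W := fun z ↦ ((ρ.fintsupport z).sort (· ≤ ·)).foldr Φ (w₀ z)
  have hG : Continuous G := by
    rw [continuous_iff_continuousAt]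
    intro z₀
    -- Near `z₀`, `G` agrees with one fixed finite composite: the extra moves act trivially by
    -- `hfilter`.
    refine ((hcont ((ρ.fintsupport z₀).sort (· ≤ ·))).continuousAt).congr ?_
    filter_upwards [ρ.eventually_fintsupport_subset z₀] with z hz
    rw [← hfilter]
    have : ((ρ.fintsupport z₀).sort (· ≤ ·)).filter (fun i ↦ z ∈ tsupport (ρ i)) =
        (ρ.fintsupport z).sort (· ≤ ·) := by
      refine List.Perm.eq_of_pairwise' (r := (· ≤ ·))
        ((Finset.pairwise_sort _ _).filter _) (Finset.pairwise_sort _ _) ?_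
      refine (List.perm_ext_iff_of_nodup ((Finset.sort_nodup _ _).filter _)
        (Finset.sort_nodup _ _)).2 fun i ↦ ?_
      simp only [List.mem_filter, Finset.mem_sort, decide_eq_true_eq]
      rw [← ρ.mem_fintsupport_iff]
      exact ⟨fun h ↦ h.2, fun h ↦ ⟨hz h, h⟩⟩
    rw [this]
  refine ⟨⟨fun z ↦ (G z).1.2, (continuous_snd.comp continuous_subtype_val).comp hG⟩, fun z ↦ ?_⟩
  have h1 : (G z).1.1.1 = z := hfst _ _
  have h2 : (G z).1.1.2 = 1 := by
    refine Subtype.ext ((htime _ _).trans ?_)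
    have hs : (((ρ.fintsupport z).sort (· ≤ ·)).map fun i ↦ ρ i z).sum = 1 := by
      rw [← List.sum_toFinset _ (Finset.sort_nodup _ _), Finset.sort_toFinset,
        ← ρ.sum_finsupport (mem_univ z)]
      refine (Finset.sum_subset (ρ.finsupport_subset_fintsupport z) fun i _ hi ↦ ?_).symm
      simpa using hi
    rw [hs]
    simp
  have h3 := (G z).2
  rw [h1, h2] at h3
  exact h3

end HomotopyLifting

/-! ### Lifting paths with prescribed endpoints -/

section PathLifting

variable {E B F : Type*} [TopologicalSpace E] [TopologicalSpace B] [TopologicalSpace F]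
  {p : E → B}

/-- Over an interval contained in a trivializing set, one can join any two points. -/
theorem Bundle.Trivialization.exists_lift_Icc [PathConnectedSpace F]
    (φ : Bundle.Trivialization F p) (γ : C(I, B)) {a b : I} (hab : a < b)
    (hγ : ∀ s ∈ Icc a b, γ s ∈ φ.baseSet) {z₀ z₁ : E} (h₀ : p z₀ = γ a) (h₁ : p z₁ = γ b) :
    ∃ L : I → E, ContinuousOn L (Icc a b) ∧ (∀ s ∈ Icc a b, p (L s) = γ s) ∧
      L a = z₀ ∧ L b = z₁ := by
  obtain ⟨α⟩ := PathConnectedSpace.joined (φ z₀).2 (φ z₁).2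
  have hab' : (0 : ℝ) < b - a := sub_pos.2 hab
  have hz₀ : z₀ ∈ φ.source := φ.mem_source.2 (h₀ ▸ hγ a (left_mem_Icc.2 hab.le))
  have hz₁ : z₁ ∈ φ.source := φ.mem_source.2 (h₁ ▸ hγ b (right_mem_Icc.2 hab.le))
  refine ⟨fun s ↦ φ.toOpenPartialHomeomorph.symm (γ s, α.extend (((s : ℝ) - a) / (b - a))),
    ?_, ?_, ?_, ?_⟩
  · refine φ.toOpenPartialHomeomorph.symm.continuousOn.comp (t := φ.target) ?_ ?_
    · refine (γ.continuous.prodMk (α.continuous_extend.comp ?_)).continuousOn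
      fun_prop
    · exact fun s hs ↦ φ.mem_target.2 (hγ s hs)
  · exact fun s hs ↦ φ.proj_symm_apply' (hγ s hs)
  · simp only [sub_self, zero_div, Path.extend_zero]
    rw [← h₀]
    exact φ.symm_apply_mk_proj hz₀
  · simp only [div_self hab'.ne', Path.extend_one]
    rw [← h₁]
    exact φ.symm_apply_mk_proj hz₁

/-- Paths lift with prescribed endpoints when the fiber is path-connected. -/
theorem IsLocallyTrivialBundle.exists_path_lift [PathConnectedSpace F]
    (hp : IsLocallyTrivialBundle F p) (γ : C(I, B)) {z₀ z₁ : E} (h₀ : p z₀ = γ 0)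
    (h₁ : p z₁ = γ 1) : ∃ L : C(I, E), (∀ s, p (L s) = γ s) ∧ L 0 = z₀ ∧ L 1 = z₁ := by
  classical
  obtain ⟨A, -, hA, t, ht0, ht, ⟨n, hn⟩, e, he⟩ :=
    hp.exists_subdivision (Z := Unit) (γ.comp ⟨Prod.snd, continuous_snd⟩) ()
  replace he : ∀ k, ∀ s ∈ Icc (t k) (t (k + 1)), γ s ∈ (e k).baseSet := fun k s hs ↦ he k () hA s hs
  -- The endpoint `z` is free for the induction, except that it must be `z₀` while `t k` is still
  -- `0`.
  suffices h : ∀ k z, p z = γ (t k) → (t k = 0 → z = z₀) → ∃ L : I → E,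
      ContinuousOn L (Icc 0 (t k)) ∧ (∀ s ∈ Icc 0 (t k), p (L s) = γ s) ∧
        L 0 = z₀ ∧ L (t k) = z by
    obtain ⟨L, hL, hpL, hL0, hL1⟩ := h n z₁ (by rw [hn, h₁]) (by simp [hn])
    have hI : Icc 0 (t n) = univ := eq_univ_of_forall fun s ↦ ⟨nonneg', hn ▸ le_one'⟩
    rw [hI] at hL hpL
    rw [hn] at hL1
    exact ⟨⟨L, continuousOn_univ.1 hL⟩, fun s ↦ hpL s (mem_univ _), hL0, hL1⟩
  intro k
  induction k with
  | zero =>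
    intro z hz hz0
    refine ⟨fun _ ↦ z, continuousOn_const, fun s hs ↦ ?_, hz0 ht0, rfl⟩
    rw [ht0, Icc_self, mem_singleton_iff] at hs
    rw [hz, ht0, hs]
  | succ k ih =>
    intro z hz hz0
    rcases (ht k.le_succ).eq_or_lt with hk | hk
    · rw [Nat.succ_eq_add_one] at hk
      rw [← hk] at hz hz0 ⊢
      exact ih z hz hz0
    · obtain ⟨z', hz', hz'0⟩ : ∃ z', p z' = γ (t k) ∧ (t k = 0 → z' = z₀) := by
        by_cases h0 : t k = 0
        · exact ⟨z₀, h0 ▸ h₀, fun _ ↦ rfl⟩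
        · exact ⟨(e k).lift z (γ (t k)), (e k).proj_lift (he k _ (left_mem_Icc.2 hk.le)),
            fun h ↦ absurd h h0⟩
      obtain ⟨L, hL, hpL, hL0, hL1⟩ := ih z' hz' hz'0
      obtain ⟨M, hM, hpM, hM0, hM1⟩ := (e k).exists_lift_Icc γ hk (he k) hz' hz
      have hIcc : Icc 0 (t (k + 1)) = Icc 0 (t k) ∪ Icc (t k) (t (k + 1)) :=
        (Icc_union_Icc_eq_Icc nonneg' hk.le).symm
      have hN0 : EqOn (fun s ↦ if s ≤ t k then L s else M s) L (Icc 0 (t k)) :=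
        fun s hs ↦ if_pos hs.2
      have hN1 : EqOn (fun s ↦ if s ≤ t k then L s else M s) M (Icc (t k) (t (k + 1))) := by
        intro s hs
        rcases hs.1.eq_or_lt with h | h
        · rw [← h, hM0, ← hL1]
          exact if_pos le_rfl
        · exact if_neg h.not_ge
      refine ⟨fun s ↦ if s ≤ t k then L s else M s, ?_, ?_, ?_, ?_⟩
      · rw [hIcc]
        exact (hL.congr hN0).union_of_isClosed (hM.congr hN1) isClosed_Icc isClosed_Icc
      · rw [hIcc]
        rintro s (hs | hs)
        · exact (congrArg p (hN0 hs)).trans (hpL s hs)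
        · exact (congrArg p (hN1 hs)).trans (hpM s hs)
      · exact (hN0 (left_mem_Icc.2 nonneg')).trans hL0
      · exact (hN1 (right_mem_Icc.2 hk.le)).trans hM1

end PathLifting

/-! ### Lifting over a one-dimensional complex -/

section CWComplex

open Metric Topology.RelCWComplex

variable {X : Type*} [TopologicalSpace X] [Topology.CWComplex (univ : Set X)]

/-- The characteristic map of a one-dimensional cell, as a path on the unit interval. -/
noncomputable def oneCellPath (i : cell (univ : Set X) 1) : C(I, X) where
  toFun s := map 1 i fun _ ↦ 2 * (s : ℝ) - 1
  continuous_toFun := by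
    refine (RelCWComplex.continuousOn 1 i).comp_continuous (by fun_prop) fun s ↦ ?_
    rw [mem_closedBall_zero_iff, pi_norm_le_iff_of_nonneg zero_le_one]
    intro _
    rw [Real.norm_eq_abs, abs_le]
    constructor <;> linarith [s.2.1, s.2.2]

theorem mem_ball_of_mem_Ioo {s : I} (hs : s ∈ Ioo (0 : I) 1) :
    (fun _ ↦ 2 * (s : ℝ) - 1 : Fin 1 → ℝ) ∈ ball 0 1 := by
  rw [mem_ball_zero_iff, pi_norm_lt_iff zero_lt_one]
  intro _
  have h0 : (0 : ℝ) < s := hs.1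
  have h1 : (s : ℝ) < 1 := hs.2
  rw [Real.norm_eq_abs, abs_lt]
  constructor <;> linarith

theorem range_oneCellPath (i : cell (univ : Set X) 1) :
    range (oneCellPath i) = closedCell 1 i := by
  refine Subset.antisymm ?_ ?_
  · rintro _ ⟨s, rfl⟩
    refine mem_image_of_mem _ ?_
    rw [mem_closedBall_zero_iff, pi_norm_le_iff_of_nonneg zero_le_one]
    intro _
    rw [Real.norm_eq_abs, abs_le]
    constructor <;> linarith [s.2.1, s.2.2]
  · rintro _ ⟨f, hf, rfl⟩
    rw [mem_closedBall_zero_iff] at hf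
    have h := (norm_le_pi_norm f 0).trans hf
    rw [Real.norm_eq_abs, abs_le] at h
    refine ⟨⟨(f 0 + 1) / 2, by linarith, by linarith⟩, ?_⟩
    refine congrArg (map 1 i) (funext fun j ↦ ?_)
    rw [Subsingleton.elim j 0]
    ring

theorem image_Ioo_oneCellPath (i : cell (univ : Set X) 1) :
    oneCellPath i '' Ioo 0 1 = openCell 1 i := by
  refine Subset.antisymm ?_ ?_
  · rintro _ ⟨s, hs, rfl⟩
    exact mem_image_of_mem _ (mem_ball_of_mem_Ioo hs)
  · rintro _ ⟨f, hf, rfl⟩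
    rw [mem_ball_zero_iff] at hf
    have h := (norm_le_pi_norm f 0).trans_lt hf
    rw [Real.norm_eq_abs, abs_lt] at h
    have h0 : 0 < (f 0 + 1) / 2 := by linarith
    have h1 : (f 0 + 1) / 2 < 1 := by linarith
    refine ⟨⟨(f 0 + 1) / 2, h0.le, h1.le⟩, ⟨h0, h1⟩, ?_⟩
    refine congrArg (map 1 i) (funext fun j ↦ ?_)
    rw [Subsingleton.elim j 0]
    ring

theorem injOn_oneCellPath (i : cell (univ : Set X) 1) : InjOn (oneCellPath i) (Ioo 0 1) := by
  intro s hs s' hs' h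
  have := (map 1 i).injOn (by rw [source_eq]; exact mem_ball_of_mem_Ioo hs)
    (by rw [source_eq]; exact mem_ball_of_mem_Ioo hs') h
  have := congrFun this 0
  exact Subtype.ext (by linarith)

theorem oneCellPath_mem_openCell_zero (i : cell (univ : Set X) 1) {s : I} (hs : s ∉ Ioo (0 : I) 1) :
    ∃ j : cell (univ : Set X) 0, oneCellPath i s ∈ openCell 0 j := by
  have h : oneCellPath i s ∈ cellFrontier 1 i := by
    refine mem_image_of_mem _ ?_
    rw [mem_sphere_zero_iff_norm]
    have hs' : s = 0 ∨ s = 1 := by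
      by_contra! h
      exact hs ⟨unitInterval.pos_iff_ne_zero.2 h.1, unitInterval.lt_one_iff_ne_one.2 h.2⟩
    rcases hs' with rfl | rfl
    · norm_num [pi_norm_const]
    · norm_num [pi_norm_const]
  obtain ⟨J, hJ⟩ := CWComplex.cellFrontier_subset_finite_closedCell 1 i
  have h' := hJ h
  simp only [mem_iUnion] at h'
  obtain ⟨m, hm, j, -, hj⟩ := h'
  obtain rfl : m = 0 := by omega
  exact ⟨j, by rwa [openCell_zero_eq_singleton, ← closedCell_zero_eq_singleton]⟩

variable {E B F : Type*} [TopologicalSpace E] [TopologicalSpace B] [TopologicalSpace F] {p : E → B}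

/-- A map from a CW complex of dimension at most one to the base of a bundle with path-connected
fiber lifts to the total space. -/
theorem IsLocallyTrivialBundle.exists_lift_of_cwDimLE_one [T2Space X] (hX : CWDimLE X 1)
    [PathConnectedSpace F] (hp : IsLocallyTrivialBundle F p) (g : C(X, B)) :
    ∃ l : C(X, E), ∀ x, p (l x) = g x := by
  have hsurj : ∀ x, ∃ z, p z = g x := by
    intro x
    obtain ⟨e, he⟩ := hp (g x)
    obtain ⟨z, -, hz⟩ := e.proj_surjOn_baseSet he
    exact ⟨z, hz⟩
  choose c hc using hsurj
  have hL : ∀ i : cell (univ : Set X) 1, ∃ L : C(I, E), (∀ s, p (L s) = g (oneCellPath i s)) ∧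
      L 0 = c (oneCellPath i 0) ∧ L 1 = c (oneCellPath i 1) :=
    fun i ↦ hp.exists_path_lift (g.comp (oneCellPath i)) (hc _) (hc _)
  choose L hpL hL0 hL1 using hL
  -- The edge lifts are compatible: an interior point determines its edge and parameter, and at
  -- endpoints every `L i` takes the value of `c`.
  have hl : ∀ x, ∃ z, p z = g x ∧ ∀ i s, oneCellPath i s = x → z = L i s := by
    intro x
    by_cases hx : ∃ i s, s ∈ Ioo (0 : I) 1 ∧ oneCellPath i s = x
    · obtain ⟨i, s, hs, rfl⟩ := hx
      refine ⟨L i s, hpL i s, fun j s' h ↦ ?_⟩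
      have hx : oneCellPath i s ∈ openCell 1 i := image_Ioo_oneCellPath i ▸ mem_image_of_mem _ hs
      by_cases hs' : s' ∈ Ioo (0 : I) 1
      · have hx' : oneCellPath i s ∈ openCell 1 j :=
          h ▸ image_Ioo_oneCellPath j ▸ mem_image_of_mem _ hs'
        have := eq_of_not_disjoint_openCell (not_disjoint_iff.2 ⟨_, hx, hx'⟩)
        obtain rfl : i = j := by simpa using this
        rw [injOn_oneCellPath i hs' hs h]
      · obtain ⟨k, hk⟩ := oneCellPath_mem_openCell_zero j hs'
        rw [h] at hk
        have := eq_of_not_disjoint_openCell (not_disjoint_iff.2 ⟨_, hx, hk⟩)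
        simp at this
    · refine ⟨c x, hc x, fun i s h ↦ ?_⟩
      have hs : s = 0 ∨ s = 1 := by
        by_contra! h'
        exact hx ⟨i, s, ⟨unitInterval.pos_iff_ne_zero.2 h'.1,
          unitInterval.lt_one_iff_ne_one.2 h'.2⟩, h⟩
      rcases hs with rfl | rfl
      · rw [hL0, h]
      · rw [hL1, h]
  choose l hpl hl using hl
  refine ⟨⟨l, ?_⟩, hpl⟩
  rw [continuous_iff_isClosed]
  intro S hS
  rw [CWComplex.closed univ _ (subset_univ _)]
  intro n j
  rcases n with _ | _ | n
  · rw [closedCell_zero_eq_singleton]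
    exact ((finite_singleton _).inter_of_right _).isClosed
  -- On a closed edge the preimage is the image of a compact set, hence closed.
  · have : l ⁻¹' S ∩ closedCell 1 j = oneCellPath j '' (L j ⁻¹' S) := by
      rw [← range_oneCellPath]
      ext x
      constructor
      · rintro ⟨hx, s, rfl⟩
        exact ⟨s, by rwa [mem_preimage, ← hl _ j s rfl], rfl⟩
      · rintro ⟨s, hs, rfl⟩
        exact ⟨by rwa [mem_preimage, hl _ j s rfl], s, rfl⟩
    refine this ▸ ?_
    exact ((hS.preimage (L j).continuous).isCompact.image (oneCellPath j).continuous).isClosed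
  · exact (hX (n + 1 + 1) (by omega)).elim j

end CWComplex

theorem proposition6p1
    {E B F X : Type*} [TopologicalSpace E] [TopologicalSpace B] [TopologicalSpace F]
    [TopologicalSpace X]
    [T2Space B] [ParacompactSpace B]
    [T2Space X] [Topology.CWComplex (Set.univ : Set X)] (hX : CWDimLE X 1)
    (hBX : Nonempty (ContinuousMap.HomotopyEquiv B X))
    [PathConnectedSpace F] (p : E → B) (hp : IsLocallyTrivialBundle F p) :
    ∃ s : C(B, E), ∀ b : B, p (s b) = b := by
  obtain ⟨h⟩ := hBX
  obtain ⟨l, hl⟩ := hp.exists_lift_of_cwDimLE_one hX h.invFun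
  obtain ⟨H⟩ := h.left_inv
  obtain ⟨s, hs⟩ := hp.exists_lift_homotopy_end
    (H.toContinuousMap.comp ⟨fun w : B × I ↦ (w.2, w.1), by fun_prop⟩) (l.comp h.toFun)
    (fun b ↦ (hl _).trans (H.apply_zero b).symm)
  exact ⟨s, fun b ↦ (hs b).trans (H.apply_one b)⟩
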